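/- Let $\rho\ge 1$, let $R=[0,\rho]\times[0,1]$, and let $P\subset R$ be a set of $n\ge 1$ points. Let $d_M$ be the Manhattan distance. For $p\in P$ let the Voronoi cell $V^P(p)$ be the set of all $z\in R$ with $d_M(z,p)<d_M(z,q)$ for every $q\in P\setminus\{p\}$. The vertical line through $p$ splits $V^P(p)$ into a left and a right half cell, the horizontal line through $p$ splits it into an upper and a lower half cell; these are the four half cells of $p$. The four arms of $V^P(p)$ are the parts in $V^P(p)$ of the rays from $p$ going right, up, left and down. An arm is a boundary arm if its end point lies on the boundary of $R$. A cell is a bridge if it has two opposite boundary arms. Suppose that (P1) every half cell of every point of $P$ has area $\frac{1}{2n}\operatorname{area}(R)$; (P2) all four arms of a cell that is not a bridge have the same length; any two opposite boundary arms of a bridge have the same length and, if $n>1$, no arm of that cell is shorter than they are. Then $P$ is a grid, that is, for some integers $a,b\ge 1$ it is the $a\times b$ grid, the set of the centres of the $ab$ congruent rectangles obtained by cutting $R$ into $a$ rows of equal height and $b$ columns of equal width. More precisely, if $\rho\ge n$, then $P$ is the $1\times n$ grid; if $\rho<n$, then $P$ is a square grid, that is, a grid such that the closure of every Voronoi cell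 $V^P(p)$, $p\in P$, is a square. -/

import Mathlib

namespace ManhattanVoronoi

noncomputable section

/-- The Manhattan distance in the plane. -/
def dM (p q : ℝ × ℝ) : ℝ := |p.1 - q.1| + |p.2 - q.2|

/-- The closed rectangle of width `ρ` and height `1`. -/
def rect (ρ : ℝ) : Set (ℝ × ℝ) := Set.Icc 0 ρ ×ˢ Set.Icc 0 1

/-- The points of the rectangle that are strictly closer to `p` than to `q`. -/
def closer (ρ : ℝ) (p q : ℝ × ℝ) : Set (ℝ × ℝ) := {z | z ∈ rect ρ ∧ dM z p < dM z q}

/-- The (open) Manhattan Voronoi cell of `p` in `P`; it is the whole rectangle if `p` is the only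
point. -/
def cell (ρ : ℝ) (P : Finset (ℝ × ℝ)) (p : ℝ × ℝ) : Set (ℝ × ℝ) :=
  {z | z ∈ rect ρ ∧ ∀ q ∈ P, q ≠ p → z ∈ closer ρ p q}

/-- The area of a planar set (two-dimensional Lebesgue measure). -/
def area (S : Set (ℝ × ℝ)) : ℝ := (MeasureTheory.volume S).toReal

/-- The four axis-parallel directions. -/
inductive Dir where
  | right : Dir
  | up : Dir
  | left : Dir
  | down : Dir

/-- The unit vector of a direction. -/
def Dir.vec : Dir → ℝ × ℝ
  | Dir.right => (1, 0)
  | Dir.up => (0, 1)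
  | Dir.left => (-1, 0)
  | Dir.down => (0, -1)

/-- The opposite direction. -/
def Dir.opp : Dir → Dir
  | Dir.right => Dir.left
  | Dir.up => Dir.down
  | Dir.left => Dir.right
  | Dir.down => Dir.up

/-- The closed half-plane to the given side of the vertical (for `right`, `left`) or horizontal
(for `up`, `down`) line through `p`. -/
def halfPlane (p : ℝ × ℝ) : Dir → Set (ℝ × ℝ)
  | Dir.right => {z | p.1 ≤ z.1}
  | Dir.up => {z | p.2 ≤ z.2}
  | Dir.left => {z | z.1 ≤ p.1}
  | Dir.down => {z | z.2 ≤ p.2}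

/-- The right, upper, left and lower half cell of `p`. -/
def halfCell (ρ : ℝ) (P : Finset (ℝ × ℝ)) (p : ℝ × ℝ) (e : Dir) : Set (ℝ × ℝ) :=
  cell ρ P p ∩ halfPlane p e

/-- The length of the arm of `p` in direction `e`, the arm being the part of the ray from `p` in
direction `e` that lies in the Voronoi cell of `p`. -/
def armLength (ρ : ℝ) (P : Finset (ℝ × ℝ)) (p : ℝ × ℝ) (e : Dir) : ℝ :=
  sSup {t : ℝ | 0 ≤ t ∧ p + t • e.vec ∈ cell ρ P p}

/-- The arm of `p` in direction `e` is a boundary arm: its end point lies on the boundary of the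
rectangle. -/
def IsBoundaryArm (ρ : ℝ) (P : Finset (ℝ × ℝ)) (p : ℝ × ℝ) (e : Dir) : Prop :=
  p + armLength ρ P p e • e.vec ∈ frontier (rect ρ)

/-- The cell of `p` is a bridge: it has two opposite boundary arms. -/
def IsBridge (ρ : ℝ) (P : Finset (ℝ × ℝ)) (p : ℝ × ℝ) : Prop :=
  ∃ e : Dir, IsBoundaryArm ρ P p e ∧ IsBoundaryArm ρ P p e.opp

/-- Every half cell has the fraction `1 / (2n)` of the area of the rectangle, `n` being the number
of points. -/
def PropP1 (ρ : ℝ) (P : Finset (ℝ × ℝ)) : Prop :=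
  ∀ p ∈ P, ∀ e : Dir, area (halfCell ρ P p e) = 1 / (2 * (P.card : ℝ)) * area (rect ρ)

/-- The arms of a cell that is not a bridge are equally long; two opposite boundary arms of a
bridge are equally long and, if there is more than one point, no arm of that cell is shorter. -/
def PropP2 (ρ : ℝ) (P : Finset (ℝ × ℝ)) : Prop :=
  ∀ p ∈ P,
    (¬ IsBridge ρ P p → ∀ e f : Dir, armLength ρ P p e = armLength ρ P p f) ∧
    (∀ e : Dir, IsBoundaryArm ρ P p e → IsBoundaryArm ρ P p e.opp →
      armLength ρ P p e = armLength ρ P p e.opp ∧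
      (1 < P.card → ∀ f : Dir, armLength ρ P p e ≤ armLength ρ P p f))

/-- `P` is the `a × b` grid (`a` rows, `b` columns): it consists of the centres of the `a * b`
congruent rectangles obtained by cutting the height into `a` and the width into `b` equal parts. -/
def IsGridOf (ρ : ℝ) (a b : ℕ) (P : Finset (ℝ × ℝ)) : Prop :=
  1 ≤ a ∧ 1 ≤ b ∧
    (P : Set (ℝ × ℝ)) = {z | ∃ i < a, ∃ j < b,
      z = (((j : ℝ) + 1 / 2) * (ρ / (b : ℝ)), ((i : ℝ) + 1 / 2) * (1 / (a : ℝ)))}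

/-- `P` is a grid. -/
def IsGrid (ρ : ℝ) (P : Finset (ℝ × ℝ)) : Prop := ∃ a b : ℕ, IsGridOf ρ a b P

/-- A closed axis-parallel square of positive side length. -/
def IsSquareSet (S : Set (ℝ × ℝ)) : Prop :=
  ∃ x y s : ℝ, 0 < s ∧ S = Set.Icc x (x + s) ×ˢ Set.Icc y (y + s)

/-- `P` is a square grid: a grid all of whose Voronoi cells are squares (up to their boundary). -/
def IsSquareGrid (ρ : ℝ) (P : Finset (ℝ × ℝ)) : Prop :=
  IsGrid ρ P ∧ ∀ p ∈ P, IsSquareSet (closure (cell ρ P p))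

end

end ManhattanVoronoi

namespace ManhattanVoronoi

open MeasureTheory

/-! An arm of `p` in direction `e` ends at the boundary, or halfway (in `dM`) to the nearest point
in the closed cone around `e` (`armLength_spec`). For `n > 1`, (P2) and `ρ ≥ 1` force each cell to
have four equal arms or all arms at least `1 / 2` (`PropP2.arms_eq_or_half_le`).

If all arms are at least `1 / 2`, every point has height `1 / 2`, the cells are vertical strips, and
(P1) spaces them evenly; the arm bound then gives `n ≤ ρ`.

Otherwise the least arm length `m` is below `1 / 2` and occurs only at cells with four equal arms.
Whatever blocks such an arm is again such a cell (`exists_blocking`). The lowest of them has a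
rectangular lower half cell of area `2 * m ^ 2` (`exists_area_lower`), so by (P1) all half cells
have this area. A cell with four arms `m` lies in the square of side `2 * m` and has its area, hence
fills it. This forces its blockers to lie straight ahead at distance `2 * m` (`InCone.eq_of_box`).
Such cells thus form a grid, which contains all of `P` by an area count; `m < 1 / 2` gives `ρ < n`.
-/

/-! ### Cones and arm lengths. -/

/-- The coordinate of a vector in the direction `e`. -/
def Dir.par : Dir → ℝ × ℝ → ℝ
  | Dir.right, v => v.1
  | Dir.up, v => v.2
  | Dir.left, v => -v.1
  | Dir.down, v => -v.2

/-- The coordinate of a vector orthogonal to the direction `e`. -/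
def Dir.perp : Dir → ℝ × ℝ → ℝ
  | Dir.right, v => v.2
  | Dir.up, v => v.1
  | Dir.left, v => v.2
  | Dir.down, v => v.1

/-- The distance from `p` to the side of the rectangle in the direction `e`. -/
def bdDist (ρ : ℝ) (p : ℝ × ℝ) : Dir → ℝ
  | Dir.right => ρ - p.1
  | Dir.up => 1 - p.2
  | Dir.left => p.1
  | Dir.down => p.2

/-- `q` lies in the closed cone with apex `p` around the direction `e`. -/
def InCone (p : ℝ × ℝ) (e : Dir) (q : ℝ × ℝ) : Prop := |e.perp (q - p)| ≤ e.par (q - p)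

lemma dM_eq_par_perp (p q : ℝ × ℝ) (e : Dir) :
    dM p q = |e.par (q - p)| + |e.perp (q - p)| := by
  cases e <;> simp [dM, Dir.par, Dir.perp, abs_sub_comm, add_comm]

lemma dM_comm (p q : ℝ × ℝ) : dM p q = dM q p := by simp [dM, abs_sub_comm]

lemma continuous_dM (q : ℝ × ℝ) : Continuous fun z => dM z q := by
  unfold dM; fun_prop

lemma dM_pos {p q : ℝ × ℝ} (h : q ≠ p) : 0 < dM p q := by
  by_contra hc
  have h1 := abs_nonneg (p.1 - q.1)
  have h2 := abs_nonneg (p.2 - q.2)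
  unfold dM at hc
  have e1 : |p.1 - q.1| = 0 := by linarith
  have e2 : |p.2 - q.2| = 0 := by linarith
  rw [abs_eq_zero, sub_eq_zero] at e1 e2
  exact h (Prod.ext e1.symm e2.symm)

lemma InCone.symm {p q : ℝ × ℝ} {e : Dir} (h : InCone p e q) : InCone q e.opp p := by
  unfold InCone at *
  cases e <;> simp only [Dir.opp, Dir.par, Dir.perp, Prod.fst_sub, Prod.snd_sub] at * <;>
    rw [abs_sub_comm] <;> linarith

lemma InCone.dM_eq {p q : ℝ × ℝ} {e : Dir} (h : InCone p e q) :
    dM p q = e.par (q - p) + |e.perp (q - p)| := by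
  rw [dM_eq_par_perp p q e, abs_of_nonneg ((abs_nonneg _).trans h)]

lemma exists_inCone (p q : ℝ × ℝ) : ∃ e, InCone p e q := by
  by_cases h : |q.1 - p.1| ≤ |q.2 - p.2|
  · rcases le_total 0 (q.2 - p.2) with h0 | h0
    · exact ⟨Dir.up, by rw [abs_of_nonneg h0] at h; exact h⟩
    · exact ⟨Dir.down, by rw [abs_of_nonpos h0] at h; exact h⟩
  · push Not at h
    rcases le_total 0 (q.1 - p.1) with h0 | h0
    · exact ⟨Dir.right, by rw [abs_of_nonneg h0] at h; exact h.le⟩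
    · exact ⟨Dir.left, by rw [abs_of_nonpos h0] at h; exact h.le⟩

/-- Along the ray in direction `e`, a point is strictly closer to `p` than to `q` exactly as long
as it has not passed half of the distance to `q`, and only points `q` in the cone matter. -/
lemma dM_ray_lt_iff {p q : ℝ × ℝ} {e : Dir} {t : ℝ} (ht : 0 ≤ t) :
    dM (p + t • e.vec) p < dM (p + t • e.vec) q ↔ (InCone p e q → 2 * t < dM p q) := by
  -- Here `(a, b)` is `q - p` in the frame of the ray. Outside the cone, `|t - a| + |b| ≥ t - a +
  -- |b| > t`.
  have key : ∀ a b : ℝ, t < |t - a| + |b| ↔ (|b| ≤ a → 2 * t < a + |b|) := by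
    intro a b
    constructor
    · intro h hb
      rcases abs_cases (t - a) with h1 | h1 <;> linarith [h1.1, h1.2]
    · intro h
      by_cases hb : |b| ≤ a
      · have := h hb
        have := neg_abs_le (t - a)
        linarith
      · push Not at hb
        have := le_abs_self (t - a)
        linarith
  have hd : InCone p e q → dM p q = e.par (q - p) + |e.perp (q - p)| := InCone.dM_eq
  have h1 : dM (p + t • e.vec) p = t := by
    cases e <;> simp [dM, Dir.vec, abs_of_nonneg ht]
  have h2 : dM (p + t • e.vec) q = |t - e.par (q - p)| + |e.perp (q - p)| := by
    rw [dM_eq_par_perp _ _ e]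
    cases e <;> simp only [Dir.par, Dir.perp, Dir.vec, Prod.fst_sub, Prod.snd_sub, Prod.fst_add,
      Prod.snd_add, Prod.smul_fst, Prod.smul_snd, smul_eq_mul, mul_one, mul_zero, add_zero] <;>
      congr 1 <;> rw [← abs_neg] <;> congr 1 <;> ring
  rw [h1, h2, key]
  constructor
  · intro h hc; rw [hd hc]; exact h hc
  · intro h hc; rw [← hd hc]; exact h hc

lemma ray_mem_rect_iff {ρ : ℝ} {p : ℝ × ℝ} (hp : p ∈ rect ρ) {e : Dir} {t : ℝ} (ht : 0 ≤ t) :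
    p + t • e.vec ∈ rect ρ ↔ t ≤ bdDist ρ p e := by
  obtain ⟨⟨h1, h2⟩, h3, h4⟩ := hp
  cases e <;> simp only [rect, Set.mem_prod, Set.mem_Icc, bdDist, Dir.vec, Prod.fst_add,
      Prod.snd_add, Prod.smul_fst, Prod.smul_snd, smul_eq_mul, mul_one, mul_zero, add_zero,
      mul_neg] <;>
    constructor <;> intro h <;> (try refine ⟨⟨?_, ?_⟩, ?_, ?_⟩) <;>
    (try obtain ⟨⟨_, _⟩, _, _⟩ := h) <;> linarith

lemma par_le_bdDist {ρ : ℝ} {p z : ℝ × ℝ} (hz : z ∈ rect ρ) (e : Dir) :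
    e.par (z - p) ≤ bdDist ρ p e := by
  obtain ⟨⟨h1, h2⟩, h3, h4⟩ := hz
  cases e <;> simp only [Dir.par, bdDist, Prod.fst_sub, Prod.snd_sub] <;> linarith

lemma mem_cell_iff {ρ : ℝ} {P : Finset (ℝ × ℝ)} {p z : ℝ × ℝ} :
    z ∈ cell ρ P p ↔ z ∈ rect ρ ∧ ∀ q ∈ P, q ≠ p → dM z p < dM z q := by
  simp only [cell, closer, Set.mem_ofPred_eq]
  constructor
  · rintro ⟨h, h'⟩; exact ⟨h, fun q hq hne => (h' q hq hne).2⟩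
  · rintro ⟨h, h'⟩; exact ⟨h, fun q hq hne => ⟨h, h' q hq hne⟩⟩

lemma exists_arm_bound (ρ : ℝ) (P : Finset (ℝ × ℝ)) (p : ℝ × ℝ) (e : Dir) :
    ∃ D, D ≤ bdDist ρ p e ∧ (∀ q ∈ P, q ≠ p → InCone p e q → 2 * D ≤ dM p q) ∧
      (D = bdDist ρ p e ∨ ∃ q ∈ P, q ≠ p ∧ InCone p e q ∧ dM p q = 2 * D) := by
  classical
  set S := P.filter fun q => q ≠ p ∧ InCone p e q with hS
  have memS : ∀ q, q ∈ S ↔ q ∈ P ∧ q ≠ p ∧ InCone p e q := fun q => by simp [hS]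
  rcases S.eq_empty_or_nonempty with h | h
  · refine ⟨_, le_rfl, fun q hq hne hc => ?_, Or.inl rfl⟩
    have := (memS q).2 ⟨hq, hne, hc⟩
    simp [h] at this
  · obtain ⟨q, hq, hmin⟩ := S.exists_min_image (fun q => dM p q) h
    obtain ⟨hqP, hne, hc⟩ := (memS q).1 hq
    rcases le_total (bdDist ρ p e) (dM p q / 2) with hle | hle
    · refine ⟨_, le_rfl, fun q' hq' hne' hc' => ?_, Or.inl rfl⟩
      have := hmin q' ((memS q').2 ⟨hq', hne', hc'⟩)
      linarith
    · refine ⟨dM p q / 2, hle, fun q' hq' hne' hc' => ?_, Or.inr ⟨q, hqP, hne, hc, by ring⟩⟩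
      have := hmin q' ((memS q').2 ⟨hq', hne', hc'⟩)
      linarith

/-- The length of an arm is the smaller one of the distance to the boundary and half of the
distance to the nearest point in the cone around it. -/
lemma armLength_spec {ρ : ℝ} {P : Finset (ℝ × ℝ)} {p : ℝ × ℝ} (hp : p ∈ rect ρ) (e : Dir)
    (hb : 0 < bdDist ρ p e) :
    0 < armLength ρ P p e ∧ armLength ρ P p e ≤ bdDist ρ p e ∧
    (∀ q ∈ P, q ≠ p → InCone p e q → 2 * armLength ρ P p e ≤ dM p q) ∧
    (armLength ρ P p e = bdDist ρ p e ∨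
      ∃ q ∈ P, q ≠ p ∧ InCone p e q ∧ dM p q = 2 * armLength ρ P p e) := by
  obtain ⟨D, h1, h2, h3⟩ := exists_arm_bound ρ P p e
  have hD : 0 < D := by
    rcases h3 with h | ⟨q, _, hne, _, h⟩
    · rwa [h]
    · have := dM_pos hne; linarith
  have hset : ∀ t, 0 ≤ t → (p + t • e.vec ∈ cell ρ P p ↔
      t ≤ bdDist ρ p e ∧ ∀ q ∈ P, q ≠ p → InCone p e q → 2 * t < dM p q) := by
    intro t ht
    rw [mem_cell_iff, ray_mem_rect_iff hp ht]
    refine and_congr Iff.rfl (forall_congr' fun q => forall_congr' fun _ =>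
      forall_congr' fun _ => dM_ray_lt_iff ht)
  have harm : armLength ρ P p e = D := by
    refine csSup_eq_of_forall_le_of_forall_lt_exists_gt ⟨0, le_rfl, ?_⟩ ?_ ?_
    · rw [hset 0 le_rfl]
      exact ⟨hb.le, fun q _ hne _ => by simpa using dM_pos hne⟩
    · rintro t ⟨ht, hmem⟩
      rw [hset t ht] at hmem
      rcases h3 with h | ⟨q, hq, hne, hc, h⟩
      · rw [h]; exact hmem.1
      · have := hmem.2 q hq hne hc; linarith
    · intro w hw
      -- `D` itself is not admissible when a point blocks the arm, so a value strictly below it is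
      -- used.
      have hlt : max w 0 < D := max_lt hw hD
      refine ⟨(max w 0 + D) / 2, ⟨by linarith [le_max_right w 0], ?_⟩,
        by linarith [le_max_left w 0]⟩
      rw [hset _ (by linarith [le_max_right w 0])]
      exact ⟨by linarith, fun q hq hne hc => by linarith [h2 q hq hne hc]⟩
  rw [harm]
  exact ⟨hD, h1, h2, h3⟩

/-- A cell extends in the direction `e` no further than its arm. -/
lemma par_le_armLength {ρ : ℝ} {P : Finset (ℝ × ℝ)} {p z : ℝ × ℝ} (hp : p ∈ rect ρ) (e : Dir)
    (hb : 0 < bdDist ρ p e) (hz : z ∈ cell ρ P p) : e.par (z - p) ≤ armLength ρ P p e := by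
  obtain ⟨-, -, -, h⟩ := armLength_spec (P := P) hp e hb
  rw [mem_cell_iff] at hz
  rcases h with h | ⟨q, hq, hne, hc, h⟩
  · rw [h]; exact par_le_bdDist hz.1 e
  · have h1 := hz.2 q hq hne
    rw [hc.dM_eq] at h
    have e1 : dM z p = |e.par (z - p)| + |e.perp (z - p)| := by
      rw [dM_comm, dM_eq_par_perp p z e]
    have e2 : dM z q = |e.par (z - p) - e.par (q - p)| + |e.perp (z - p) - e.perp (q - p)| := by
      rw [dM_comm, dM_eq_par_perp q z e]
      cases e <;> simp only [Dir.par, Dir.perp, Prod.fst_sub, Prod.snd_sub] <;> congr 1 <;>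
        congr 1 <;> ring
    rw [e1, e2] at h1
    unfold InCone at hc
    by_contra! hlt
    -- Moving `z` off the ray gains at most `|e.perp (q - p)|` over `q`, which the cone condition
    -- absorbs.
    have t1 : |e.perp (z - p) - e.perp (q - p)| ≤ |e.perp (z - p)| + |e.perp (q - p)| := abs_sub _ _
    have t2 := le_abs_self (e.par (z - p))
    have t3 := abs_nonneg (e.perp (q - p))
    rcases abs_cases (e.par (z - p) - e.par (q - p)) with h4 | h4 <;> linarith [h4.1, h4.2]

/-! ### Areas of boxes and cells. -/

lemma volume_box (a b c d : ℝ) : volume (Set.Icc a b ×ˢ Set.Icc c d : Set (ℝ × ℝ)) =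
    ENNReal.ofReal (b - a) * ENNReal.ofReal (d - c) := by
  rw [Measure.volume_eq_prod, Measure.prod_prod, Real.volume_Icc, Real.volume_Icc]

lemma volume_box_ne_top (a b c d : ℝ) :
    volume (Set.Icc a b ×ˢ Set.Icc c d : Set (ℝ × ℝ)) ≠ ⊤ := by
  rw [volume_box]; exact ENNReal.mul_ne_top ENNReal.ofReal_ne_top ENNReal.ofReal_ne_top

lemma area_box {a b c d : ℝ} (hab : a ≤ b) (hcd : c ≤ d) :
    area (Set.Icc a b ×ˢ Set.Icc c d) = (b - a) * (d - c) := by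
  rw [area, volume_box, ENNReal.toReal_mul, ENNReal.toReal_ofReal (by linarith),
    ENNReal.toReal_ofReal (by linarith)]

lemma area_open_box {a b c d : ℝ} (hab : a ≤ b) (hcd : c ≤ d) :
    area (Set.Ioo a b ×ˢ Set.Ioo c d) = (b - a) * (d - c) := by
  rw [area, Measure.volume_eq_prod, Measure.prod_prod, Real.volume_Ioo, Real.volume_Ioo,
    ENNReal.toReal_mul, ENNReal.toReal_ofReal (by linarith), ENNReal.toReal_ofReal (by linarith)]

lemma area_eq_of_between {S : Set (ℝ × ℝ)} {a b c d : ℝ} (hab : a ≤ b) (hcd : c ≤ d)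
    (h1 : Set.Ioo a b ×ˢ Set.Ioo c d ⊆ S) (h2 : S ⊆ Set.Icc a b ×ˢ Set.Icc c d) :
    area S = (b - a) * (d - c) := by
  refine le_antisymm ?_ ?_
  · rw [← area_box hab hcd]
    exact ENNReal.toReal_mono (volume_box_ne_top _ _ _ _) (measure_mono h2)
  · rw [← area_open_box hab hcd]
    exact ENNReal.toReal_mono (ne_top_of_le_ne_top (volume_box_ne_top a b c d) (measure_mono h2))
      (measure_mono h1)

lemma area_rect {ρ : ℝ} (hρ : 0 ≤ ρ) : area (rect ρ) = ρ := by
  rw [rect, area_box hρ zero_le_one]; ring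

lemma cell_subset_rect (ρ : ℝ) (P : Finset (ℝ × ℝ)) (p : ℝ × ℝ) : cell ρ P p ⊆ rect ρ :=
  fun _ hz => hz.1

lemma measurableSet_cell (ρ : ℝ) (P : Finset (ℝ × ℝ)) (p : ℝ × ℝ) :
    MeasurableSet (cell ρ P p) := by
  have : cell ρ P p = rect ρ ∩ ⋂ q ∈ P, {z | q ≠ p → dM z p < dM z q} := by
    ext z; simp [mem_cell_iff]
  rw [this]
  refine (measurableSet_Icc.prod measurableSet_Icc).inter
    (Finset.measurableSet_biInter _ fun q _ => ?_)
  by_cases hq : q = p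
  · simp [hq]
  · simpa [hq] using (isOpen_lt (continuous_dM p) (continuous_dM q)).measurableSet

lemma volume_horizontal_line (c : ℝ) : volume {z : ℝ × ℝ | z.2 = c} = 0 := by
  have : {z : ℝ × ℝ | z.2 = c} = Set.univ ×ˢ {c} := by ext z; simp
  rw [this, Measure.volume_eq_prod, Measure.prod_prod]; simp

lemma area_cell_eq_add (ρ : ℝ) (P : Finset (ℝ × ℝ)) (p : ℝ × ℝ) :
    area (cell ρ P p) = area (halfCell ρ P p Dir.up) + area (halfCell ρ P p Dir.down) := by
  have hD : MeasurableSet (halfCell ρ P p Dir.down) :=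
    (measurableSet_cell ρ P p).inter (measurableSet_le measurable_snd measurable_const)
  have hun : cell ρ P p = halfCell ρ P p Dir.up ∪ halfCell ρ P p Dir.down := by
    rw [halfCell, halfCell, ← Set.inter_union_distrib_left]
    refine (Set.inter_eq_left.2 fun z _ => ?_).symm
    exact le_total p.2 z.2
  have hfin : ∀ e, volume (halfCell ρ P p e) ≠ ⊤ := fun e =>
    ne_top_of_le_ne_top (volume_box_ne_top 0 ρ 0 1)
      (measure_mono (Set.inter_subset_left.trans (cell_subset_rect ρ P p)))
  have hdis : AEDisjoint volume (halfCell ρ P p Dir.up) (halfCell ρ P p Dir.down) := by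
    refine measure_mono_null ?_ (volume_horizontal_line p.2)
    rintro z ⟨⟨-, h1⟩, -, h2⟩
    exact le_antisymm h2 h1
  unfold area
  conv_lhs => rw [hun]
  rw [measure_union₀ hD.nullMeasurableSet hdis,
    ENNReal.toReal_add (hfin _) (hfin _)]

/-- A subset of full measure is dense: an open piece of the box missed by the closure would have
positive measure. -/
lemma closure_eq_box {S : Set (ℝ × ℝ)} {a b c d : ℝ} (hab : a < b) (hcd : c < d)
    (hS : MeasurableSet S) (h : S ⊆ Set.Icc a b ×ˢ Set.Icc c d)
    (harea : area S = (b - a) * (d - c)) : closure S = Set.Icc a b ×ˢ Set.Icc c d := by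
  refine (closure_minimal h (isClosed_Icc.prod isClosed_Icc)).antisymm ?_
  have hSfin : volume S ≠ ⊤ := ne_top_of_le_ne_top (volume_box_ne_top a b c d) (measure_mono h)
  have hvol : volume S = volume (Set.Icc a b ×ˢ Set.Icc c d : Set (ℝ × ℝ)) := by
    rw [← ENNReal.toReal_eq_toReal_iff' hSfin (volume_box_ne_top a b c d)]
    exact harea.trans (area_box hab.le hcd.le).symm
  have hnull : volume ((Set.Icc a b ×ˢ Set.Icc c d : Set (ℝ × ℝ)) \ S) = 0 := by
    rw [measure_sdiff h hS.nullMeasurableSet hSfin, hvol, tsub_self]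
  have hopen : (Set.Ioo a b ×ˢ Set.Ioo c d : Set (ℝ × ℝ)) ⊆ closure S := by
    intro z hz
    by_contra hc
    have ho : IsOpen ((Set.Ioo a b ×ˢ Set.Ioo c d : Set (ℝ × ℝ)) ∩ (closure S)ᶜ) :=
      (isOpen_Ioo.prod isOpen_Ioo).inter isClosed_closure.isOpen_compl
    refine (ho.measure_pos volume ⟨z, hz, hc⟩).ne' (measure_mono_null ?_ hnull)
    rintro w ⟨⟨h1, h2⟩, h3⟩
    exact ⟨⟨Set.Ioo_subset_Icc_self h1, Set.Ioo_subset_Icc_self h2⟩,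
      fun h' => h3 (subset_closure h')⟩
  have := closure_minimal hopen isClosed_closure
  rwa [closure_prod_eq, closure_Ioo hab.ne, closure_Ioo hcd.ne] at this

/-! ### Grids from equidistant steps. -/

/-- A nonempty set of reals in `[0, L]` that is closed under steps of length `2h`, except where the
boundary is at distance `h`, contains all odd multiples of `h` up to `L`. -/
lemma exists_equidistant {S : Set ℝ} {L h : ℝ} (hh : 0 < h) (hne : S.Nonempty)
    (hS : ∀ x ∈ S, 0 ≤ x ∧ x ≤ L) (hr : ∀ x ∈ S, x + h = L ∨ x + 2 * h ∈ S)
    (hl : ∀ x ∈ S, x = h ∨ x - 2 * h ∈ S) :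
    ∃ b : ℕ, 1 ≤ b ∧ 2 * h * b = L ∧ ∀ j < b, (2 * (j : ℝ) + 1) * h ∈ S := by
  -- Otherwise the steps to the left never stop and leave `[0, L]`.
  have hstart : h ∈ S := by
    by_contra hc
    obtain ⟨x, hx⟩ := hne
    have hall : ∀ k : ℕ, x - 2 * h * k ∈ S := by
      intro k
      induction k with
      | zero => simpa using hx
      | succ k ih =>
        rcases hl _ ih with h1 | h1
        · rw [h1] at ih; exact absurd ih hc
        · convert h1 using 1; push_cast; ring
    obtain ⟨k, hk⟩ := exists_nat_gt (x / (2 * h))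
    rw [div_lt_iff₀ (by linarith)] at hk
    linarith [(hS _ (hall k)).1]
  -- If the right end were never reached exactly, the steps to the right would pass `L`.
  have hex : ∃ j : ℕ, 2 * h * (j + 1) = L ∧ ∀ i ≤ j, (2 * (i : ℝ) + 1) * h ∈ S := by
    by_contra! hc
    have hall : ∀ j : ℕ, ∀ i ≤ j, (2 * (i : ℝ) + 1) * h ∈ S := by
      intro j
      induction j with
      | zero => intro i hi; obtain rfl : i = 0 := by omega
                simpa using hstart
      | succ j ih =>
        intro i hi
        rcases Nat.lt_or_ge i (j + 1) with hlt | hge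
        · exact ih i (by omega)
        · obtain rfl : i = j + 1 := by omega
          rcases hr _ (ih j le_rfl) with h1 | h1
          · obtain ⟨i, hi, hn⟩ := hc j (by linarith)
            exact absurd (ih i hi) hn
          · convert h1 using 1; push_cast; ring
    obtain ⟨k, hk⟩ := exists_nat_gt (L / (2 * h))
    rw [div_lt_iff₀ (by linarith)] at hk
    linarith [(hS _ (hall k k le_rfl)).2]
  obtain ⟨j, h1, h2⟩ := hex
  exact ⟨j + 1, by omega, by push_cast; exact h1, fun i hi => h2 i (by omega)⟩

/-- The steps only produce an `a × b` grid inside `M`; since `4 * w * h * (a * b) = ρ`, `harea`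
shows that it already has as many points as `P`. -/
lemma isGridOf_of_steps {ρ : ℝ} {P : Finset (ℝ × ℝ)} {M : Set (ℝ × ℝ)} {w h : ℝ}
    (hw : 0 < w) (hh : 0 < h) (hM : M.Nonempty) (hMP : M ⊆ P) (hrect : M ⊆ rect ρ)
    (harea : 4 * w * h * P.card = ρ)
    (hright : ∀ p ∈ M, p.1 + w = ρ ∨ (p.1 + 2 * w, p.2) ∈ M)
    (hleft : ∀ p ∈ M, p.1 = w ∨ (p.1 - 2 * w, p.2) ∈ M)
    (hup : ∀ p ∈ M, p.2 + h = 1 ∨ (p.1, p.2 + 2 * h) ∈ M)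
    (hdown : ∀ p ∈ M, p.2 = h ∨ (p.1, p.2 - 2 * h) ∈ M) :
    ∃ a b : ℕ, 2 * h * a = 1 ∧ 2 * w * b = ρ ∧ a * b = P.card ∧ IsGridOf ρ a b P ∧ M = P := by
  classical
  obtain ⟨⟨x₀, y₀⟩, h0⟩ := hM
  obtain ⟨b, hb1, hb, hrow⟩ := exists_equidistant (S := {x | (x, y₀) ∈ M}) (L := ρ) hw ⟨x₀, h0⟩
    (fun x hx => (hrect hx).1) (fun x hx => hright _ hx) (fun x hx => hleft _ hx)
  have hcol : ∀ x, (∃ y, (x, y) ∈ M) → ∃ a : ℕ, 1 ≤ a ∧ 2 * h * a = 1 ∧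
      ∀ i < a, (x, (2 * (i : ℝ) + 1) * h) ∈ M := fun x hx =>
    exists_equidistant (S := {y | (x, y) ∈ M}) (L := 1) hh hx
      (fun y hy => (hrect hy).2) (fun y hy => hup _ hy) (fun y hy => hdown _ hy)
  obtain ⟨a, ha1, ha, -⟩ := hcol x₀ ⟨y₀, h0⟩
  have ha0 : (0 : ℝ) < a := by exact_mod_cast ha1
  have hb0 : (0 : ℝ) < b := by exact_mod_cast hb1
  have hmem : ∀ i < a, ∀ j < b, ((2 * (j : ℝ) + 1) * w, (2 * (i : ℝ) + 1) * h) ∈ M := by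
    intro i hi j hj
    obtain ⟨a', -, ha', h'⟩ := hcol _ ⟨y₀, hrow j hj⟩
    refine h' i ?_
    -- Each column has its own row count, but `2 * h * a = 1` determines it.
    have : (a' : ℝ) = a := mul_left_cancel₀ (by positivity : 2 * h ≠ 0) (ha'.trans ha.symm)
    have : a' = a := by exact_mod_cast this
    omega
  have hab : a * b = P.card := by
    have : (4 * w * h) * ((a * b : ℕ) : ℝ) = (4 * w * h) * (P.card : ℝ) := by
      rw [harea, ← hb]; push_cast
      linear_combination (2 * w * b) * ha
    exact_mod_cast mul_left_cancel₀ (by positivity) this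
  set f : ℕ × ℕ → ℝ × ℝ := fun k => ((2 * (k.2 : ℝ) + 1) * w, (2 * (k.1 : ℝ) + 1) * h) with hf
  have hfinj : Function.Injective f := by
    rintro ⟨i, j⟩ ⟨i', j'⟩ hk
    simp only [hf, Prod.mk.injEq] at hk
    have e1 := mul_right_cancel₀ hw.ne' hk.1
    have e2 := mul_right_cancel₀ hh.ne' hk.2
    have e1' : (j : ℝ) = j' := by linarith
    have e2' : (i : ℝ) = i' := by linarith
    exact Prod.ext (by exact_mod_cast e2') (by exact_mod_cast e1')
  have himM : ∀ z ∈ (Finset.range a ×ˢ Finset.range b).image f, z ∈ M := by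
    intro z hz
    obtain ⟨⟨i, j⟩, hk, rfl⟩ := Finset.mem_image.1 hz
    rw [Finset.mem_product, Finset.mem_range, Finset.mem_range] at hk
    exact hmem i hk.1 j hk.2
  have himage : (Finset.range a ×ˢ Finset.range b).image f = P := by
    refine Finset.eq_of_subset_of_card_le (fun z hz => hMP (himM z hz)) ?_
    rw [Finset.card_image_of_injective _ hfinj, Finset.card_product, Finset.card_range,
      Finset.card_range, hab]
  refine ⟨a, b, ha, hb, hab, ⟨ha1, hb1, ?_⟩, hMP.antisymm fun z hz => himM z (by rwa [himage])⟩
  have hw' : ρ / b = 2 * w := by rw [div_eq_iff hb0.ne', hb]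
  have hh' : 1 / (a : ℝ) = 2 * h := by rw [div_eq_iff ha0.ne', ha]
  rw [← himage, hw', hh']
  ext z
  simp only [Finset.coe_image, Set.mem_image, Finset.mem_coe, Finset.mem_product,
    Finset.mem_range, Set.mem_ofPred_eq, Prod.exists, hf]
  constructor
  · rintro ⟨i, j, ⟨hi, hj⟩, rfl⟩
    exact ⟨i, hi, j, hj, Prod.ext (by ring) (by ring)⟩
  · rintro ⟨i, hi, j, hj, rfl⟩
    exact ⟨i, j, ⟨hi, hj⟩, Prod.ext (by simp only; ring) (by simp only; ring)⟩

/-! ### First consequences of (P1) and (P2). -/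

/-- A point on a side of the rectangle would have a half cell of measure zero, against (P1). -/
lemma bdDist_pos {ρ : ℝ} (hρ : 0 < ρ) {P : Finset (ℝ × ℝ)} (h1 : PropP1 ρ P) {p : ℝ × ℝ}
    (hp : p ∈ P) (hpr : p ∈ rect ρ) (e : Dir) : 0 < bdDist ρ p e := by
  by_contra! hc
  have hn : 0 < P.card := Finset.card_pos.2 ⟨p, hp⟩
  have harea := h1 p hp e
  rw [area_rect hρ.le] at harea
  have hpos : 0 < area (halfCell ρ P p e) := by rw [harea]; positivity
  have hzero : ∀ a b c d : ℝ, a = b ∨ c = d →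
      halfCell ρ P p e ⊆ Set.Icc a b ×ˢ Set.Icc c d → False := by
    intro a b c d habcd hsub
    have : volume (halfCell ρ P p e) = 0 := measure_mono_null hsub <| by
      rw [volume_box]; rcases habcd with rfl | rfl <;> simp
    rw [area, this] at hpos
    simp at hpos
  obtain ⟨⟨h2, h3⟩, h4, h5⟩ := hpr
  cases e <;> simp only [bdDist] at hc
  · refine hzero p.1 ρ 0 1 (Or.inl (by linarith)) ?_
    rintro z ⟨⟨⟨⟨h6, h7⟩, h8, h9⟩, -⟩, h10⟩
    exact ⟨⟨h10, h7⟩, h8, h9⟩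
  · refine hzero 0 ρ p.2 1 (Or.inr (by linarith)) ?_
    rintro z ⟨⟨⟨⟨h6, h7⟩, h8, h9⟩, -⟩, h10⟩
    exact ⟨⟨h6, h7⟩, h10, h9⟩
  · refine hzero 0 p.1 0 1 (Or.inl (by linarith)) ?_
    rintro z ⟨⟨⟨⟨h6, h7⟩, h8, h9⟩, -⟩, h10⟩
    exact ⟨⟨h6, h10⟩, h8, h9⟩
  · refine hzero 0 ρ 0 p.2 (Or.inr (by linarith)) ?_
    rintro z ⟨⟨⟨⟨h6, h7⟩, h8, h9⟩, -⟩, h10⟩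
    exact ⟨⟨h6, h7⟩, h8, h10⟩

/-- Since `p` is interior, its arm can meet the frontier only on the side that it faces. -/
lemma IsBoundaryArm.bdDist_le {ρ : ℝ} {P : Finset (ℝ × ℝ)} {p : ℝ × ℝ}
    (hb : ∀ e, 0 < bdDist ρ p e) {e : Dir} (h0 : 0 ≤ armLength ρ P p e)
    (h : IsBoundaryArm ρ P p e) : bdDist ρ p e ≤ armLength ρ P p e := by
  by_contra! hlt
  refine h.2 ?_
  rw [rect, interior_prod_eq, interior_Icc, interior_Icc]
  have b1 := hb Dir.right
  have b2 := hb Dir.up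
  have b3 := hb Dir.left
  have b4 := hb Dir.down
  simp only [bdDist] at b1 b2 b3 b4
  cases e <;> simp only [Set.mem_prod, Set.mem_Ioo, bdDist, Dir.vec, Prod.fst_add,
      Prod.snd_add, Prod.smul_fst, Prod.smul_snd, smul_eq_mul, mul_one, mul_zero, add_zero,
      mul_neg] at hlt ⊢ <;> refine ⟨⟨?_, ?_⟩, ?_, ?_⟩ <;> linarith

/-- If there are at least two points, then all arms of a cell have the same length or all of them
have length at least `1 / 2`. -/
lemma PropP2.arms_eq_or_half_le {ρ : ℝ} (hρ : 1 ≤ ρ) {P : Finset (ℝ × ℝ)} (h2 : PropP2 ρ P)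
    (hcard : 1 < P.card) {p : ℝ × ℝ} (hp : p ∈ P) (hpr : p ∈ rect ρ)
    (hb : ∀ e, 0 < bdDist ρ p e) :
    (∀ e f, armLength ρ P p e = armLength ρ P p f) ∨ ∀ e, 1 / 2 ≤ armLength ρ P p e := by
  by_cases hB : IsBridge ρ P p
  · right
    obtain ⟨e, he, he'⟩ := hB
    obtain ⟨heq, hle⟩ := (h2 p hp).2 e he he'
    have t1 := he.bdDist_le hb (armLength_spec hpr e (hb e)).1.le
    have t2 := he'.bdDist_le hb (armLength_spec hpr e.opp (hb e.opp)).1.le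
    -- The two distances add up to `ρ` or to `1`; equal arms therefore have length at least `1 / 2`.
    have t3 : 1 ≤ bdDist ρ p e + bdDist ρ p e.opp := by
      cases e <;> simp only [bdDist, Dir.opp] <;> linarith
    intro f
    linarith [hle hcard f]
  · exact Or.inl ((h2 p hp).1 hB)

/-! ### Vertical strips. -/

/-- If all points lie on the horizontal centre line, then all cells are vertical strips. -/
lemma isGridOf_of_centre_line {ρ : ℝ} (hρ : 0 < ρ) {P : Finset (ℝ × ℝ)} (hne : P.Nonempty)
    (hP : ∀ p ∈ P, p ∈ rect ρ) (h1 : PropP1 ρ P) (hc : ∀ p ∈ P, p.2 = 1 / 2) :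
    IsGridOf ρ 1 P.card P ∧ ∀ p ∈ P, armLength ρ P p Dir.right = ρ / (2 * P.card) := by
  have hn : (0 : ℝ) < P.card := by exact_mod_cast Finset.card_pos.2 hne
  have hb : ∀ p ∈ P, ∀ e, 0 < bdDist ρ p e := fun p hp e => bdDist_pos hρ h1 hp (hP p hp) e
  have harm : ∀ p ∈ P, armLength ρ P p Dir.right = ρ / (2 * P.card) ∧
      armLength ρ P p Dir.left = ρ / (2 * P.card) := by
    intro p hp
    have har : ∀ e, area (halfCell ρ P p e) = ρ / (2 * P.card) := fun e => by
      rw [h1 p hp e, area_rect hρ.le]; ring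
    have hy := hc p hp
    have hpr := hP p hp
    have hoff : ∀ q ∈ P, q ≠ p → q.1 ≠ p.1 := fun q hq hqp h =>
      hqp (Prod.ext h ((hc q hq).trans hy.symm))
    constructor
    · obtain ⟨a1, a2, a3, -⟩ := armLength_spec (P := P) hpr Dir.right (hb p hp _)
      rw [← har Dir.right, area_eq_of_between (a := p.1) (b := p.1 + armLength ρ P p Dir.right)
        (c := 0) (d := 1) (by linarith) zero_le_one]
      · ring
      · rintro z ⟨⟨z1, z2⟩, z3, z4⟩
        refine ⟨mem_cell_iff.2 ⟨⟨⟨by linarith [hpr.1.1], ?_⟩, z3.le, z4.le⟩, ?_⟩, z1.le⟩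
        · simp only [bdDist] at a2; linarith
        · intro q hq hqp
          have hqy := hc q hq
          rw [dM, dM, hy, hqy, abs_of_pos (by linarith : 0 < z.1 - p.1)]
          -- With all points at one height the vertical terms cancel, leaving a comparison of
          -- abscissae.
          have hlt : z.1 - p.1 < |z.1 - q.1| := by
            rcases lt_or_gt_of_ne (hoff q hq hqp) with h | h
            · linarith [le_abs_self (z.1 - q.1)]
            · have hcone : InCone p Dir.right q := by
                simp only [InCone, Dir.perp, Dir.par, Prod.snd_sub, Prod.fst_sub, hy, hqy,
                  sub_self, abs_zero]
                linarith
              have := a3 q hq hqp hcone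
              rw [hcone.dM_eq] at this
              simp only [Dir.perp, Dir.par, Prod.snd_sub, Prod.fst_sub, hy, hqy,
                  sub_self, abs_zero] at this
              linarith [neg_abs_le (z.1 - q.1)]
          linarith
      · rintro z ⟨hz, hz'⟩
        have := par_le_armLength hpr Dir.right (hb p hp _) hz
        simp only [Dir.par, Prod.fst_sub] at this
        exact ⟨⟨hz', by linarith⟩, hz.1.2⟩
    · obtain ⟨a1, a2, a3, -⟩ := armLength_spec (P := P) hpr Dir.left (hb p hp _)
      rw [← har Dir.left, area_eq_of_between (a := p.1 - armLength ρ P p Dir.left) (b := p.1)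
        (c := 0) (d := 1) (by linarith) zero_le_one]
      · ring
      · rintro z ⟨⟨z1, z2⟩, z3, z4⟩
        refine ⟨mem_cell_iff.2 ⟨⟨⟨?_, by linarith [hpr.1.2]⟩, z3.le, z4.le⟩, ?_⟩, z2.le⟩
        · simp only [bdDist] at a2; linarith
        · intro q hq hqp
          have hqy := hc q hq
          rw [dM, dM, hy, hqy, abs_of_neg (by linarith : z.1 - p.1 < 0)]
          have hlt : -(z.1 - p.1) < |z.1 - q.1| := by
            rcases lt_or_gt_of_ne (hoff q hq hqp) with h | h
            · have hcone : InCone p Dir.left q := by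
                simp only [InCone, Dir.perp, Dir.par, Prod.snd_sub, Prod.fst_sub, hy, hqy,
                  sub_self, abs_zero]
                linarith
              have := a3 q hq hqp hcone
              rw [hcone.dM_eq] at this
              simp only [Dir.perp, Dir.par, Prod.snd_sub, Prod.fst_sub, hy, hqy,
                  sub_self, abs_zero] at this
              linarith [le_abs_self (z.1 - q.1)]
            · linarith [neg_abs_le (z.1 - q.1)]
          linarith
      · rintro z ⟨hz, hz'⟩
        have := par_le_armLength hpr Dir.left (hb p hp _) hz
        simp only [Dir.par, Prod.fst_sub] at this
        exact ⟨⟨by linarith, hz'⟩, hz.1.2⟩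
  refine ⟨?_, fun p hp => (harm p hp).1⟩
  have hw : 0 < ρ / (2 * P.card) := by positivity
  have hright : ∀ p ∈ P, p.1 + ρ / (2 * P.card) = ρ ∨ (p.1 + 2 * (ρ / (2 * P.card)), p.2) ∈ P := by
    intro p hp
    obtain ⟨-, -, -, h | ⟨q, hq, -, hcone, hd⟩⟩ :=
      armLength_spec (P := P) (hP p hp) Dir.right (hb p hp _)
    · rw [(harm p hp).1, bdDist] at h
      left; linarith
    · right
      rw [hcone.dM_eq, (harm p hp).1] at hd
      simp only [Dir.perp, Dir.par, Prod.snd_sub, Prod.fst_sub, hc p hp, hc q hq, sub_self,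
        abs_zero] at hd
      have : q = (p.1 + 2 * (ρ / (2 * P.card)), p.2) :=
        Prod.ext (by simp only; linarith) ((hc q hq).trans (hc p hp).symm)
      rw [← this]; exact hq
  have hleft : ∀ p ∈ P, p.1 = ρ / (2 * P.card) ∨ (p.1 - 2 * (ρ / (2 * P.card)), p.2) ∈ P := by
    intro p hp
    obtain ⟨-, -, -, h | ⟨q, hq, -, hcone, hd⟩⟩ :=
      armLength_spec (P := P) (hP p hp) Dir.left (hb p hp _)
    · rw [(harm p hp).2, bdDist] at h
      left; linarith
    · right
      rw [hcone.dM_eq, (harm p hp).2] at hd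
      simp only [Dir.perp, Dir.par, Prod.snd_sub, Prod.fst_sub, hc p hp, hc q hq, sub_self,
        abs_zero] at hd
      have : q = (p.1 - 2 * (ρ / (2 * P.card)), p.2) :=
        Prod.ext (by simp only; linarith) ((hc q hq).trans (hc p hp).symm)
      rw [← this]; exact hq
  obtain ⟨a, b, ha, -, hab, hgrid, -⟩ := isGridOf_of_steps (ρ := ρ) (P := P) (M := P)
    (w := ρ / (2 * P.card)) (h := 1 / 2) hw (by norm_num) hne subset_rfl (fun p hp => hP p hp)
    (by field_simp; ring) hright hleft (fun p hp => Or.inl (by rw [hc p hp]; norm_num))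
    (fun p hp => Or.inl (hc p hp))
  have ha' : (a : ℝ) = 1 := by linarith
  obtain rfl : a = 1 := by exact_mod_cast ha'
  rw [one_mul] at hab
  rwa [← hab]

/-! ### Square cells. -/

/-- The closed axis-parallel square with centre `p` and side length `2m`. -/
def box (p : ℝ × ℝ) (m : ℝ) : Set (ℝ × ℝ) :=
  Set.Icc (p.1 - m) (p.1 + m) ×ˢ Set.Icc (p.2 - m) (p.2 + m)

/-- A point `q` at distance `2m` in the cone around the direction `e`, which is not closer than `p`
to any point of the square around `p`, lies in the direction `e` exactly. -/
lemma InCone.eq_of_box {p q : ℝ × ℝ} {e : Dir} {m : ℝ} (hm : 0 < m) (h : InCone p e q)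
    (hd : dM p q = 2 * m) (hbox : ∀ z ∈ box p m, dM z p ≤ dM z q) :
    q = p + (2 * m) • e.vec := by
  -- `(u, v)` is `q - p` in the frame of `e`. The corner of the far side on the same side as `v`
  -- gives `2 * m ≤ u - |v|`, while `u + |v| = 2 * m`.
  have key : ∀ u v : ℝ, |v| ≤ u → u + |v| = 2 * m →
      (∀ t, |t| ≤ m → m + |t| ≤ |m - u| + |t - v|) → v = 0 ∧ u = 2 * m := by
    intro u v h1 h2 h3
    have hv : |v| = 0 := by
      refine le_antisymm ?_ (abs_nonneg v)
      rw [abs_of_nonpos (by linarith : m - u ≤ 0)] at h3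
      rcases le_total 0 v with h0 | h0
      · have h4 := h3 m (abs_of_pos hm).le
        rw [abs_of_nonneg h0] at *
        rw [abs_of_pos hm, abs_of_nonneg (by linarith : 0 ≤ m - v)] at h4
        linarith
      · have h4 := h3 (-m) (by rw [abs_neg, abs_of_pos hm])
        rw [abs_of_nonpos h0] at *
        rw [abs_neg, abs_of_pos hm, abs_of_nonpos (by linarith : -m - v ≤ 0)] at h4
        linarith
    exact ⟨abs_eq_zero.1 hv, by linarith⟩
  rw [h.dM_eq] at hd
  obtain ⟨e1, e2⟩ := key _ _ h hd (by
    intro t ht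
    rw [abs_le] at ht
    cases e
    · have := hbox (p.1 + m, p.2 + t) ⟨⟨by simp only; linarith, by simp only; linarith⟩,
        by simp only; linarith [ht.1], by simp only; linarith [ht.2]⟩
      rw [dM_comm, dM_comm _ q, dM_eq_par_perp p _ Dir.right,
        dM_eq_par_perp q _ Dir.right] at this
      simp only [Dir.par, Dir.perp, Prod.fst_sub, Prod.snd_sub, add_sub_cancel_left,
        abs_of_pos hm] at this ⊢
      rwa [show m - (q.1 - p.1) = p.1 + m - q.1 by ring,
        show t - (q.2 - p.2) = p.2 + t - q.2 by ring]
    · have := hbox (p.1 + t, p.2 + m) ⟨⟨by simp only; linarith [ht.1], by simp only; linarith [ht.2]⟩,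
        by simp only; linarith, by simp only; linarith⟩
      rw [dM_comm, dM_comm _ q, dM_eq_par_perp p _ Dir.up, dM_eq_par_perp q _ Dir.up] at this
      simp only [Dir.par, Dir.perp, Prod.fst_sub, Prod.snd_sub, add_sub_cancel_left,
        abs_of_pos hm] at this ⊢
      rwa [show m - (q.2 - p.2) = p.2 + m - q.2 by ring,
        show t - (q.1 - p.1) = p.1 + t - q.1 by ring]
    · have := hbox (p.1 - m, p.2 + t) ⟨⟨by simp only; linarith, by simp only; linarith⟩,
        by simp only; linarith [ht.1], by simp only; linarith [ht.2]⟩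
      rw [dM_comm, dM_comm _ q, dM_eq_par_perp p _ Dir.left, dM_eq_par_perp q _ Dir.left] at this
      simp only [Dir.par, Dir.perp, Prod.fst_sub, Prod.snd_sub, add_sub_cancel_left,
        sub_sub_cancel_left, neg_neg, abs_of_pos hm] at this ⊢
      rwa [show m - -(q.1 - p.1) = -(p.1 - m - q.1) by ring,
        show t - (q.2 - p.2) = p.2 + t - q.2 by ring]
    · have := hbox (p.1 + t, p.2 - m) ⟨⟨by simp only; linarith [ht.1], by simp only; linarith [ht.2]⟩,
        by simp only; linarith, by simp only; linarith⟩
      rw [dM_comm, dM_comm _ q, dM_eq_par_perp p _ Dir.down, dM_eq_par_perp q _ Dir.down] at this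
      simp only [Dir.par, Dir.perp, Prod.fst_sub, Prod.snd_sub, add_sub_cancel_left,
        sub_sub_cancel_left, neg_neg, abs_of_pos hm] at this ⊢
      rwa [show m - -(q.2 - p.2) = -(p.2 - m - q.2) by ring,
        show t - (q.1 - p.1) = p.1 + t - q.1 by ring])
  cases e <;> simp only [Dir.par, Dir.perp, Prod.fst_sub, Prod.snd_sub] at e1 e2 <;>
    refine Prod.ext ?_ ?_ <;> simp only [Dir.vec, Prod.fst_add, Prod.snd_add, Prod.smul_fst,
      Prod.smul_snd, smul_eq_mul, mul_one, mul_zero, add_zero, mul_neg] <;> linarith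

/-- The points all of whose arms have length `m`. -/
def equalArms (ρ : ℝ) (P : Finset (ℝ × ℝ)) (m : ℝ) : Set (ℝ × ℝ) :=
  {p | p ∈ P ∧ ∀ e, armLength ρ P p e = m}

lemma two_mul_le_dM {ρ : ℝ} {P : Finset (ℝ × ℝ)} (hP : ∀ p ∈ P, p ∈ rect ρ)
    (hb : ∀ p ∈ P, ∀ e, 0 < bdDist ρ p e) {m : ℝ} (hmin : ∀ p ∈ P, ∀ e, m ≤ armLength ρ P p e)
    {p q : ℝ × ℝ} (hp : p ∈ P) (hq : q ∈ P) (hne : q ≠ p) : 2 * m ≤ dM p q := by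
  obtain ⟨e, he⟩ := exists_inCone p q
  have := (armLength_spec (hP p hp) e (hb p hp e)).2.2.1 q hq hne he
  linarith [hmin p hp e]

/-- The arms of minimal length end at the boundary or are blocked by a cell which also has an arm
of minimal length. -/
lemma exists_blocking {ρ : ℝ} {P : Finset (ℝ × ℝ)} (hP : ∀ p ∈ P, p ∈ rect ρ)
    (hb : ∀ p ∈ P, ∀ e, 0 < bdDist ρ p e) {m : ℝ} (hmin : ∀ p ∈ P, ∀ e, m ≤ armLength ρ P p e)
    (hM : ∀ p ∈ P, ∀ e, armLength ρ P p e = m → p ∈ equalArms ρ P m)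
    {p : ℝ × ℝ} (hp : p ∈ equalArms ρ P m) (e : Dir) :
    bdDist ρ p e = m ∨ ∃ q ∈ equalArms ρ P m, InCone p e q ∧ dM p q = 2 * m := by
  obtain ⟨-, -, -, h | ⟨q, hq, hne, hc, hd⟩⟩ :=
    armLength_spec (P := P) (hP p hp.1) e (hb p hp.1 e)
  · exact Or.inl (h.symm.trans (hp.2 e))
  · rw [hp.2 e] at hd
    -- The blocked point `p` in turn bounds the opposite arm of `q` by `m`, so that arm is minimal
    -- too.
    refine Or.inr ⟨q, hM q hq e.opp (le_antisymm ?_ (hmin q hq e.opp)), hc, hd⟩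
    have := (armLength_spec (P := P) (hP q hq) e.opp (hb q hq _)).2.2.1 p hp.1 hne.symm hc.symm
    rw [dM_comm, hd] at this
    linarith

/-- The lowest one of the points with arms of minimal length has a lower half cell which is a full
rectangle. -/
lemma exists_area_lower {ρ : ℝ} {P : Finset (ℝ × ℝ)} (hP : ∀ p ∈ P, p ∈ rect ρ)
    (hb : ∀ p ∈ P, ∀ e, 0 < bdDist ρ p e) {m : ℝ} (hm : 0 < m)
    (hmin : ∀ p ∈ P, ∀ e, m ≤ armLength ρ P p e)
    (hM : ∀ p ∈ P, ∀ e, armLength ρ P p e = m → p ∈ equalArms ρ P m)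
    (hne : (equalArms ρ P m).Nonempty) :
    ∃ p ∈ P, area (halfCell ρ P p Dir.down) = 2 * m ^ 2 := by
  have hfin : (equalArms ρ P m).Finite := P.finite_toSet.subset fun p hp => hp.1
  obtain ⟨p, hp, hlow⟩ := hfin.exists_minimalFor Prod.snd _ hne
  have hy : p.2 = m := by
    rcases exists_blocking hP hb hmin hM hp Dir.down with h | ⟨q, hq, hc, hd⟩
    · exact h
    · exfalso
      rw [hc.dM_eq] at hd
      simp only [InCone, Dir.par, Dir.perp, Prod.fst_sub, Prod.snd_sub] at hc hd
      have := hlow hq (by linarith)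
      linarith
  have hpr := hP p hp.1
  have hbd : ∀ e, m ≤ bdDist ρ p e := fun e => by
    rw [← hp.2 e]; exact (armLength_spec hpr e (hb p hp.1 e)).2.1
  have hr := hbd Dir.right
  have hl := hbd Dir.left
  simp only [bdDist] at hr hl
  refine ⟨p, hp.1, ?_⟩
  rw [area_eq_of_between (a := p.1 - m) (b := p.1 + m) (c := 0) (d := m) (by linarith) hm.le]
  · ring
  · rintro z ⟨⟨z1, z2⟩, z3, z4⟩
    refine ⟨mem_cell_iff.2 ⟨⟨⟨by linarith, by linarith⟩, z3.le, by linarith [hpr.2.2]⟩, ?_⟩,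
      by rw [← hy] at z4; exact z4.le⟩
    intro q hq hqp
    have hd := two_mul_le_dM hP hb hmin hp.1 hq hqp
    -- No point is lower than `p`, as every downward arm needs room `m`. So for `z` below `p` the
    -- heights of `p` and `q` enter linearly, and `dM p q ≥ 2 * m` with `|z.1 - p.1| < m` decides.
    have hqy : m ≤ q.2 := (hmin q hq Dir.down).trans
      (armLength_spec (P := P) (hP q hq) Dir.down (hb q hq _)).2.1
    rw [dM, hy, abs_of_nonpos (by linarith : m - q.2 ≤ 0)] at hd
    rw [dM, dM, hy, abs_of_neg (by linarith : z.2 - m < 0),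
      abs_of_neg (by linarith : z.2 - q.2 < 0)]
    have hz : |z.1 - p.1| < m := abs_lt.2 ⟨by linarith, by linarith⟩
    have := abs_sub_le p.1 z.1 q.1
    rw [abs_sub_comm p.1 z.1] at this
    linarith
  · rintro z ⟨hz, hz'⟩
    have b1 := par_le_armLength hpr Dir.right (hb p hp.1 _) hz
    have b2 := par_le_armLength hpr Dir.left (hb p hp.1 _) hz
    rw [hp.2] at b1 b2
    simp only [Dir.par, Prod.fst_sub] at b1 b2
    exact ⟨⟨by linarith, by linarith⟩, hz.1.2.1, by rw [← hy]; exact hz'⟩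

/-- The cells with arms of minimal length are squares if their area is that of a square. -/
lemma closure_cell_eq_box {ρ : ℝ} {P : Finset (ℝ × ℝ)} (hP : ∀ p ∈ P, p ∈ rect ρ)
    (hb : ∀ p ∈ P, ∀ e, 0 < bdDist ρ p e) {m : ℝ} (hm : 0 < m) {p : ℝ × ℝ}
    (hp : p ∈ equalArms ρ P m) (harea : ∀ e, area (halfCell ρ P p e) = 2 * m ^ 2) :
    closure (cell ρ P p) = box p m := by
  refine closure_eq_box (by linarith) (by linarith) (measurableSet_cell ρ P p) ?_ ?_
  · intro z hz
    have b := fun e => par_le_armLength (hP p hp.1) e (hb p hp.1 e) hz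
    have b1 := b Dir.right
    have b2 := b Dir.up
    have b3 := b Dir.left
    have b4 := b Dir.down
    rw [hp.2] at b1 b2 b3 b4
    simp only [Dir.par, Prod.fst_sub, Prod.snd_sub] at b1 b2 b3 b4
    exact ⟨⟨by linarith, by linarith⟩, by linarith, by linarith⟩
  · rw [area_cell_eq_add, harea, harea]; ring

/-- If the minimal arm length `m` is attained only at cells with four equal arms, then the cells
are squares of side length `2m`. -/
lemma isGridOf_of_equalArms {ρ : ℝ} (hρ : 0 < ρ) {P : Finset (ℝ × ℝ)}
    (hP : ∀ p ∈ P, p ∈ rect ρ) (h1 : PropP1 ρ P) {m : ℝ} (hm : 0 < m)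
    (hmin : ∀ p ∈ P, ∀ e, m ≤ armLength ρ P p e)
    (hM : ∀ p ∈ P, ∀ e, armLength ρ P p e = m → p ∈ equalArms ρ P m)
    (hne : (equalArms ρ P m).Nonempty) :
    ∃ a b : ℕ, 2 * m * a = 1 ∧ 2 * m * b = ρ ∧ a * b = P.card ∧ IsGridOf ρ a b P ∧
      ∀ p ∈ P, closure (cell ρ P p) = box p m := by
  have hb : ∀ p ∈ P, ∀ e, 0 < bdDist ρ p e := fun p hp e => bdDist_pos hρ h1 hp (hP p hp) e
  obtain ⟨p₀, hp₀, h0⟩ := exists_area_lower hP hb hm hmin hM hne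
  have hcard : (0 : ℝ) < P.card := by exact_mod_cast Finset.card_pos.2 ⟨p₀, hp₀⟩
  have harea : ∀ p ∈ P, ∀ e, area (halfCell ρ P p e) = 2 * m ^ 2 := fun p hp e => by
    rw [h1 p hp e, ← h0, h1 p₀ hp₀]
  have hsize : 4 * m * m * P.card = ρ := by
    rw [h1 p₀ hp₀, area_rect hρ.le] at h0
    field_simp at h0
    linarith
  have hbox : ∀ p ∈ equalArms ρ P m, closure (cell ρ P p) = box p m := fun p hp =>
    closure_cell_eq_box hP hb hm hp (harea p hp.1)
  have hstep : ∀ p ∈ equalArms ρ P m, ∀ e,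
      bdDist ρ p e = m ∨ p + (2 * m) • e.vec ∈ equalArms ρ P m := by
    intro p hp e
    rcases exists_blocking hP hb hmin hM hp e with h | ⟨q, hq, hc, hd⟩
    · exact Or.inl h
    · right
      rw [← hc.eq_of_box hm hd]
      · exact hq
      · rw [← hbox p hp]
        -- The strict inequality on the cell becomes a weak one on its closure, the square.
        have hcl : IsClosed {z | dM z p ≤ dM z q} :=
          isClosed_le (continuous_dM p) (continuous_dM q)
        have hqp : q ≠ p := by
          rintro rfl
          simp only [dM, sub_self, abs_zero] at hd
          linarith
        exact closure_minimal (fun z hz => ((mem_cell_iff.1 hz).2 q hq.1 hqp).le) hcl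
  obtain ⟨a, b, ha, hb', hab, hgrid, hMP⟩ := isGridOf_of_steps (M := equalArms ρ P m) hm hm hne
    (fun p hp => hp.1) (fun p hp => hP p hp.1) hsize
    (fun p hp => by
      refine (hstep p hp Dir.right).imp (fun h => ?_) (fun h => ?_)
      · simp only [bdDist] at h; linarith
      · convert h using 1; ext <;> simp [Dir.vec])
    (fun p hp => by
      refine (hstep p hp Dir.left).imp (fun h => h) (fun h => ?_)
      convert h using 1; ext <;> simp [Dir.vec, sub_eq_add_neg])
    (fun p hp => by
      refine (hstep p hp Dir.up).imp (fun h => ?_) (fun h => ?_)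
      · simp only [bdDist] at h; linarith
      · convert h using 1; ext <;> simp [Dir.vec])
    (fun p hp => by
      refine (hstep p hp Dir.down).imp (fun h => h) (fun h => ?_)
      convert h using 1; ext <;> simp [Dir.vec, sub_eq_add_neg])
  exact ⟨a, b, ha, hb', hab, hgrid, fun p hp => hbox p (by rw [hMP]; exact hp)⟩

/-! ### The case of a single point, and the theorem. -/

/-- For one point (P2) does not compare bridge arms with the others, so the height is read off from
the area of the lower half cell. -/
lemma snd_eq_half_of_card_eq_one {ρ : ℝ} (hρ : 0 < ρ) {P : Finset (ℝ × ℝ)}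
    (hcard : P.card = 1) (hP : ∀ p ∈ P, p ∈ rect ρ) (h1 : PropP1 ρ P) :
    ∀ p ∈ P, p.2 = 1 / 2 := by
  obtain ⟨q, rfl⟩ := Finset.card_eq_one.1 hcard
  intro p hp
  have harea := h1 p hp Dir.down
  obtain rfl := Finset.mem_singleton.1 hp
  have hpr := hP p hp
  have hcell : halfCell ρ {p} p Dir.down = Set.Icc 0 ρ ×ˢ Set.Icc 0 p.2 := by
    ext z
    simp only [halfCell, Set.mem_inter_iff, mem_cell_iff, Finset.mem_singleton, halfPlane, rect,
      Set.mem_prod, Set.mem_Icc, Set.mem_ofPred_eq]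
    constructor
    · rintro ⟨⟨⟨h1, h2, -⟩, -⟩, h3⟩; exact ⟨h1, h2, h3⟩
    · rintro ⟨h1, h2, h3⟩
      exact ⟨⟨⟨h1, h2, h3.trans hpr.2.2⟩, fun q hq hne => absurd hq hne⟩, h3⟩
  rw [hcell, area_box hρ.le hpr.2.1, area_rect hρ.le, hcard] at harea
  refine mul_left_cancel₀ hρ.ne' ?_
  push_cast at harea
  linarith

end ManhattanVoronoi

theorem lemma4p2 (ρ : ℝ) (hρ : 1 ≤ ρ) (n : ℕ) (hn : 1 ≤ n)
    (P : Finset (ℝ × ℝ)) (hcard : P.card = n)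
    (hP : ∀ p ∈ P, p ∈ ManhattanVoronoi.rect ρ)
    (h1 : ManhattanVoronoi.PropP1 ρ P) (h2 : ManhattanVoronoi.PropP2 ρ P) :
    ManhattanVoronoi.IsGrid ρ P ∧
      ((n : ℝ) ≤ ρ → ManhattanVoronoi.IsGridOf ρ 1 n P) ∧
      (ρ < (n : ℝ) → ManhattanVoronoi.IsSquareGrid ρ P) := by
  open ManhattanVoronoi in
  subst hcard
  have hρ0 : 0 < ρ := by linarith
  have hPne : P.Nonempty := Finset.card_pos.1 hn
  have hcard0 : (0 : ℝ) < P.card := by exact_mod_cast hn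
  have hb : ∀ p ∈ P, ∀ e, 0 < bdDist ρ p e := fun p hp e => bdDist_pos hρ0 h1 hp (hP p hp) e
  rcases Nat.eq_or_lt_of_le hn with hcard | hcard
  · obtain ⟨hgrid, -⟩ := isGridOf_of_centre_line hρ0 hPne hP h1
      (snd_eq_half_of_card_eq_one hρ0 hcard.symm hP h1)
    refine ⟨⟨_, _, hgrid⟩, fun _ => hgrid, fun hlt => ?_⟩
    rw [← hcard] at hlt
    push_cast at hlt
    linarith
  have hdich := fun p hp => h2.arms_eq_or_half_le hρ hcard hp (hP p hp) (hb p hp)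
  by_cases hall : ∀ p ∈ P, ∀ e, 1 / 2 ≤ armLength ρ P p e
  · have hc : ∀ p ∈ P, p.2 = 1 / 2 := by
      intro p hp
      have hu := (hall p hp Dir.up).trans (armLength_spec (hP p hp) Dir.up (hb p hp _)).2.1
      have hd := (hall p hp Dir.down).trans (armLength_spec (hP p hp) Dir.down (hb p hp _)).2.1
      simp only [bdDist] at hu hd
      linarith
    obtain ⟨hgrid, harm⟩ := isGridOf_of_centre_line hρ0 hPne hP h1 hc
    refine ⟨⟨_, _, hgrid⟩, fun _ => hgrid, fun hlt => ?_⟩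
    obtain ⟨p, hp⟩ := hPne
    have := hall p hp Dir.right
    rw [harm p hp, le_div_iff₀ (by positivity)] at this
    linarith
  · have heq : ∀ p ∈ P, ∀ e, armLength ρ P p e < 1 / 2 → ∀ f,
        armLength ρ P p f = armLength ρ P p e := by
      intro p hp e he f
      rcases hdich p hp with h | h
      · exact h f e
      · linarith [h e]
    push Not at hall
    obtain ⟨p₁, hp₁, e₁, he₁⟩ := hall
    -- Right arms suffice: any arm below `1 / 2` equals the right arm of its cell.
    obtain ⟨p₀, hp₀, hmin₀⟩ := P.exists_min_image (fun p => armLength ρ P p Dir.right) hPne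
    set m := armLength ρ P p₀ Dir.right with hm
    have hm1 : m < 1 / 2 := by
      have := hmin₀ p₁ hp₁
      rw [heq p₁ hp₁ e₁ he₁] at this
      linarith
    have hmin : ∀ p ∈ P, ∀ e, m ≤ armLength ρ P p e := by
      intro p hp e
      by_contra! hlt
      have := hmin₀ p hp
      rw [heq p hp e (by linarith)] at this
      linarith
    have hM : ∀ p ∈ P, ∀ e, armLength ρ P p e = m → p ∈ equalArms ρ P m := fun p hp e he =>
      ⟨hp, fun f => (heq p hp e (by linarith) f).trans he⟩
    have hm0 : 0 < m := (armLength_spec (hP p₀ hp₀) Dir.right (hb p₀ hp₀ _)).1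
    obtain ⟨a, b, ha, hb', hab, hgrid, hbox⟩ := isGridOf_of_equalArms hρ0 hP h1 hm0 hmin hM
      ⟨p₀, hM p₀ hp₀ Dir.right rfl⟩
    -- From `2 * m < 1` follow `1 < a` and `ρ < b`, so `ρ < b < a * b`.
    have hlt : ρ < P.card := by
      have ha2 : (1 : ℝ) < a := by nlinarith
      have hb0 : (0 : ℝ) < b := by
        by_contra! hle
        nlinarith
      have : ρ < b := by nlinarith
      rw [← hab]
      push_cast
      nlinarith
    refine ⟨⟨a, b, hgrid⟩, fun hle => absurd hle (not_le.2 hlt), fun _ => ⟨⟨a, b, hgrid⟩, ?_⟩⟩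
    intro p hp
    refine ⟨p.1 - m, p.2 - m, 2 * m, by linarith, ?_⟩
    rw [hbox p hp, box]
    congr 2 <;> ring
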